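/- Let $\mathfrak{A}$ be a complex unital algebra and let $\varphi,\psi:\mathfrak{A}\to\mathbb{C}$ be linear functionals with $\varphi(1)=\psi(1)=1$. The free cumulants $R^n$ and the c-free cumulants ${}^cR^n$ are the functionals of $a_1,\dots,a_n\in\mathfrak A$, $n\ge 1$, determined recursively by \[ \psi(a_1\cdots a_n)=\sum R^p(a_{i(1)},\dots,a_{i(p)})\Big[\prod_{k=1}^{p-1}\psi(a_{i(k)+1}\cdots a_{i(k+1)-1})\Big]\psi(a_{i(p)+1}\cdots a_n), \] \[ \varphi(a_1\cdots a_n)=\sum {}^cR^p(a_{i(1)},\dots,a_{i(p)})\Big[\prod_{k=1}^{p-1}\psi(a_{i(k)+1}\cdots a_{i(k+1)-1})\Big]\varphi(a_{i(p)+1}\cdots a_n), \] where the sums run over all $1\le p\le n$ and all $1=i(1)<i(2)<\dots<i(p)\le n$, and empty products are $1$. For $X\in\mathfrak{A}$ put $R_X(z)=\sum_{n\ge1}R^n(X,\dots,X)z^n$, ${}^cR_X(z)=\sum_{n\ge1}{}^cR^n(X,\dots,X)z^n$ and $M_X(z)=\sum_{n\ge1}\varphi(X^n)z^n$. If $\psi(X)\neq0$,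 then $R_X$ has a substitutional inverse $R_X^{\langle-1\rangle}$, and one defines the formal power series \[ T_X(z)=\Big(\tfrac1z R_X(z)\Big)\circ R_X^{\langle-1\rangle}(z),\qquad {}^cT_X(z)=\Big(\tfrac1z\,{}^cR_X(z)\Big)\circ R_X^{\langle-1\rangle}(z). \] Elements $X,Y\in\mathfrak A$ are called c-free if the unital subalgebras $\mathfrak{A}_1,\mathfrak{A}_2$ generated by $X$ and by $Y$ satisfy $\psi(a_1\cdots a_n)=0$ and $\varphi(a_1\cdots a_n)=\varphi(a_1)\cdots\varphi(a_n)$ for all $n\ge1$ and all $a_j\in\mathfrak{A}_{\varepsilon(j)}$ with $\psi(a_j)=0$ and $\varepsilon(1)\ne\varepsilon(2)\ne\dots\ne\varepsilon(n)$. Then the following hold. (i) If $\varphi=\psi$ and $\psi(X)\ne0$, then ${}^cT_X=T_X$. (ii) $M_X$ can be obtained from $T_X$ and ${}^cT_X$ via substitutional composition, substitutional inverse and algebraic operations: there is a single finite expression in two unknown power series, built from these, the variable $z$ and the constant $1$ by addition, negation, multiplication, multiplicative inversion (of series with nonzero constant term), substitutional composition (with inner series without constant term) and substitutional inversion (of series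 without constant term and with nonzero linear term), such that for all $\mathfrak{A},\varphi,\psi$ and all $X\in\mathfrak{A}$ with $\psi(X)\neq0$, the expression at $(T_X,{}^cT_X)$ is well defined and its value is $M_X$. (iii) If $X,Y\in\mathfrak{A}$ are c-free, $\psi(X)\ne0$ and $\psi(Y)\neq0$, then $\psi(XY)\ne0$ and ${}^cT_{XY}(z)={}^cT_X(z)\,{}^cT_Y(z)$. -/

import Mathlib

open scoped PowerSeries

universe u

namespace CFree

noncomputable section

section Cumulants

variable {A : Type u} [Ring A] [Algebra ℂ A]

/- A choice of indices `1 = i(1) < i(2) < ... < i(p) ≤ n` is the same as a composition of `n`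
into `p` parts: the `k`-th block consists of the indices `i(k), i(k) + 1, ..., i(k+1) - 1`
(and `i(p), ..., n` for the last one). -/

/-- The tuple `(a_{i(1)}, ..., a_{i(p)})` of the first entries of the blocks. -/
def heads {n : ℕ} (c : Composition n) (a : Fin n → A) : Fin c.length → A :=
  fun k => a (c.embedding k ⟨0, c.one_le_blocksFun k⟩)

/-- The product `a_{i(k)+1} ... a_{i(k+1)-1}` of the remaining entries of the `k`-th block
(for the last block, the product `a_{i(p)+1} ... a_n`). An empty product is `1`. -/
def gap {n : ℕ} (c : Composition n) (a : Fin n → A) (k : Fin c.length) : A :=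
  (List.ofFn fun j => a (c.embedding k j)).tail.prod

/-- The free cumulant `R^n(a_1, ..., a_n)` with respect to `ψ`: the defining recurrence
`freeCumulant_recurrence`, solved for its term of top order. -/
def freeCumulant (ψ : A →ₗ[ℂ] ℂ) (n : ℕ) (a : Fin n → A) : ℂ :=
  ψ (List.ofFn a).prod -
    ∑ c : {c : Composition n // c.length < n},
      freeCumulant ψ c.1.length (heads c.1 a) * ∏ k, ψ (gap c.1 a k)
termination_by n
decreasing_by exact c.2

/-- The c-free cumulant `ᶜR^n(a_1, ..., a_n)` with respect to `(φ, ψ)`: the defining recurrence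
`cfreeCumulant_recurrence`, solved for its term of top order. The last gap is evaluated
by `φ`, the others by `ψ`. -/
def cfreeCumulant (φ ψ : A →ₗ[ℂ] ℂ) (n : ℕ) (a : Fin n → A) : ℂ :=
  φ (List.ofFn a).prod -
    ∑ c : {c : Composition n // c.length < n},
      cfreeCumulant φ ψ c.1.length (heads c.1 a) *
        ∏ k : Fin c.1.length,
          if (k : ℕ) + 1 = c.1.length then φ (gap c.1 a k) else ψ (gap c.1 a k)
termination_by n
decreasing_by exact c.2

theorem gap_ones {n : ℕ} (a : Fin n → A) (k : Fin (Composition.ones n).length) :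
    gap (Composition.ones n) a k = 1 := by
  simp [gap]

theorem apply_heads_ones (K : (n : ℕ) → (Fin n → A) → ℂ) {n : ℕ} (a : Fin n → A) :
    K (Composition.ones n).length (heads (Composition.ones n) a) = K n a := by
  have key : ∀ (m : ℕ) (h : m = n) (b : Fin m → A),
      (∀ k : Fin m, b k = a (Fin.cast h k)) → K m b = K n a := by
    rintro m rfl b hb
    congr 1
    funext k
    exact hb k
  refine key _ (Composition.ones_length n) _ fun k => ?_
  simp only [heads]
  rw [Composition.ones_embedding]
  rfl

theorem sum_composition {n : ℕ} (f : Composition n → ℂ) :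
    ∑ c, f c = f (Composition.ones n) + ∑ c : {c : Composition n // c.length < n}, f c.1 := by
  classical
  rw [← Finset.add_sum_erase _ _ (Finset.mem_univ (Composition.ones n))]
  congr 1
  refine (Finset.sum_subtype _ (fun c => ?_) f)
  simp only [Finset.mem_erase, Finset.mem_univ, and_true]
  rw [Ne, Composition.eq_ones_iff_le_length, not_le]

/-- `ψ(a_1 ... a_n) = ∑_p ∑_{1 = i(1) < ... < i(p) ≤ n} R^p(a_{i(1)}, ..., a_{i(p)})
∏_{k < p} ψ(a_{i(k)+1} ... a_{i(k+1)-1}) ψ(a_{i(p)+1} ... a_n)`. -/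
theorem freeCumulant_recurrence (ψ : A →ₗ[ℂ] ℂ) (hψ : ψ 1 = 1) (n : ℕ) (a : Fin n → A) :
    ψ (List.ofFn a).prod =
      ∑ c : Composition n, freeCumulant ψ c.length (heads c a) * ∏ k, ψ (gap c a k) := by
  rw [sum_composition, apply_heads_ones (freeCumulant ψ)]
  simp only [gap_ones, hψ, Finset.prod_const_one, mul_one]
  conv_rhs => rw [freeCumulant]
  ring

/-- `φ(a_1 ... a_n) = ∑_p ∑_{1 = i(1) < ... < i(p) ≤ n} ᶜR^p(a_{i(1)}, ..., a_{i(p)})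
∏_{k < p} ψ(a_{i(k)+1} ... a_{i(k+1)-1}) φ(a_{i(p)+1} ... a_n)`. -/
theorem cfreeCumulant_recurrence (φ ψ : A →ₗ[ℂ] ℂ) (hφ : φ 1 = 1) (hψ : ψ 1 = 1)
    (n : ℕ) (a : Fin n → A) :
    φ (List.ofFn a).prod =
      ∑ c : Composition n, cfreeCumulant φ ψ c.length (heads c a) *
        ∏ k : Fin c.length,
          if (k : ℕ) + 1 = c.length then φ (gap c a k) else ψ (gap c a k) := by
  rw [sum_composition, apply_heads_ones (cfreeCumulant φ ψ)]
  simp only [gap_ones, hφ, hψ, ite_self, Finset.prod_const_one, mul_one]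
  conv_rhs => rw [cfreeCumulant]
  ring

/-- The `R`-transform `R_X(z) = ∑_{n ≥ 1} R^n(X, ..., X) z^n`. -/
def rTransform (ψ : A →ₗ[ℂ] ℂ) (X : A) : ℂ⟦X⟧ :=
  PowerSeries.mk fun n => if n = 0 then 0 else freeCumulant ψ n fun _ => X

/-- The `ᶜR`-transform `ᶜR_X(z) = ∑_{n ≥ 1} ᶜR^n(X, ..., X) z^n`. -/
def crTransform (φ ψ : A →ₗ[ℂ] ℂ) (X : A) : ℂ⟦X⟧ :=
  PowerSeries.mk fun n => if n = 0 then 0 else cfreeCumulant φ ψ n fun _ => X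

/-- The moment generating series `∑_{n ≥ 1} φ(X^n) z^n`. -/
def momentSeries (φ : A →ₗ[ℂ] ℂ) (X : A) : ℂ⟦X⟧ :=
  PowerSeries.mk fun n => if n = 0 then 0 else φ (X ^ n)

/-- `F(z) / z`, for a power series `F` without constant term. -/
def divZ (F : ℂ⟦X⟧) : ℂ⟦X⟧ :=
  PowerSeries.mk fun n => PowerSeries.coeff (n + 1) F

theorem coeff_one_rTransform (ψ : A →ₗ[ℂ] ℂ) (X : A) :
    PowerSeries.coeff 1 (rTransform ψ X) = ψ X := by
  have : IsEmpty {c : Composition 1 // c.length < 1} := by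
    refine ⟨fun c => ?_⟩
    have h1 := c.1.length_pos_of_pos one_pos
    have h2 := c.2
    omega
  rw [rTransform, PowerSeries.coeff_mk, if_neg one_ne_zero, freeCumulant]
  simp

theorem isUnit_coeff_one_rTransform {ψ : A →ₗ[ℂ] ℂ} {X : A} (hX : ψ X ≠ 0) :
    IsUnit (PowerSeries.coeff 1 (rTransform ψ X)) := by
  rw [coeff_one_rTransform]
  exact hX.isUnit

/-- The substitutional inverse `R_X^{⟨-1⟩}` of the `R`-transform, for `ψ(X) ≠ 0`. -/
def rTransformInv (ψ : A →ₗ[ℂ] ℂ) (X : A) (hX : ψ X ≠ 0) : ℂ⟦X⟧ :=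
  (rTransform ψ X).substInvOfIsUnit (isUnit_coeff_one_rTransform hX)

/-- The `T`-transform `T_X = (R_X(z) / z) ∘ R_X^{⟨-1⟩}`, for `ψ(X) ≠ 0`. -/
def tTransform (ψ : A →ₗ[ℂ] ℂ) (X : A) (hX : ψ X ≠ 0) : ℂ⟦X⟧ :=
  (divZ (rTransform ψ X)).subst (rTransformInv ψ X hX)

/-- The `ᶜT`-transform `ᶜT_X = (ᶜR_X(z) / z) ∘ R_X^{⟨-1⟩}`, for `ψ(X) ≠ 0`. -/
def ctTransform (φ ψ : A →ₗ[ℂ] ℂ) (X : A) (hX : ψ X ≠ 0) : ℂ⟦X⟧ :=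
  (divZ (crTransform φ ψ X)).subst (rTransformInv ψ X hX)

/-- Conditional freeness of a family of (unital) subalgebras with respect to `(φ, ψ)`. -/
def IsCFree {ι : Type*} (φ ψ : A →ₗ[ℂ] ℂ) (S : ι → Subalgebra ℂ A) : Prop :=
  ∀ (n : ℕ) (ε : Fin (n + 1) → ι) (a : Fin (n + 1) → A),
    (∀ j, a j ∈ S (ε j)) →
    (∀ j : Fin n, ε j.castSucc ≠ ε j.succ) →
    (∀ j, ψ (a j) = 0) →
      ψ (List.ofFn a).prod = 0 ∧ φ (List.ofFn a).prod = ∏ j, φ (a j)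

/-- Two elements are c-free if the subalgebras that they generate are c-free. -/
def AreCFree (φ ψ : A →ₗ[ℂ] ℂ) (X Y : A) : Prop :=
  IsCFree φ ψ fun i : Fin 2 => Algebra.adjoin ℂ {![X, Y] i}

end Cumulants

/-- Formal expressions in two unknown power series, built from these, the variable `z` and the
constant `1` by the algebraic operations, substitutional composition and substitutional
inversion. -/
inductive SeriesExpr : Type
  | fst : SeriesExpr
  | snd : SeriesExpr
  | z : SeriesExpr
  | one : SeriesExpr
  | add : SeriesExpr → SeriesExpr → SeriesExpr
  | neg : SeriesExpr → SeriesExpr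
  | mul : SeriesExpr → SeriesExpr → SeriesExpr
  | inv : SeriesExpr → SeriesExpr
  | comp : SeriesExpr → SeriesExpr → SeriesExpr
  | compInv : SeriesExpr → SeriesExpr

/-- `Evaluates P Q e F`: with the unknowns replaced by `P` and `Q`, all operations in the
expression `e` are legitimate, and its value is `F`. A multiplicative inverse requires a nonzero
constant term, a composition `F ∘ G` requires that `G` has no constant term, and a substitutional
inverse of `F` requires that `F` has no constant term and a nonzero linear term. -/
inductive Evaluates (P Q : ℂ⟦X⟧) : SeriesExpr → ℂ⟦X⟧ → Prop
  | fst : Evaluates P Q .fst P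
  | snd : Evaluates P Q .snd Q
  | z : Evaluates P Q .z PowerSeries.X
  | one : Evaluates P Q .one 1
  | add {e f : SeriesExpr} {F G : ℂ⟦X⟧} :
      Evaluates P Q e F → Evaluates P Q f G → Evaluates P Q (.add e f) (F + G)
  | neg {e : SeriesExpr} {F : ℂ⟦X⟧} : Evaluates P Q e F → Evaluates P Q (.neg e) (-F)
  | mul {e f : SeriesExpr} {F G : ℂ⟦X⟧} :
      Evaluates P Q e F → Evaluates P Q f G → Evaluates P Q (.mul e f) (F * G)
  | inv {e : SeriesExpr} {F : ℂ⟦X⟧} :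
      Evaluates P Q e F → PowerSeries.constantCoeff F ≠ 0 → Evaluates P Q (.inv e) F⁻¹
  | comp {e f : SeriesExpr} {F G : ℂ⟦X⟧} :
      Evaluates P Q e F → Evaluates P Q f G → PowerSeries.constantCoeff G = 0 →
      Evaluates P Q (.comp e f) (F.subst G)
  | compInv {e : SeriesExpr} {F : ℂ⟦X⟧} :
      Evaluates P Q e F → PowerSeries.constantCoeff F = 0 →
      (h : IsUnit (PowerSeries.coeff 1 F)) →
      Evaluates P Q (.compInv e) (F.substInvOfIsUnit h)

/-- The value of an expression is unique. -/
theorem Evaluates.unique {P Q : ℂ⟦X⟧} {e : SeriesExpr} {F : ℂ⟦X⟧} (hF : Evaluates P Q e F) :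
    ∀ {G : ℂ⟦X⟧}, Evaluates P Q e G → F = G := by
  induction hF with
  | fst => intro G hG; cases hG; rfl
  | snd => intro G hG; cases hG; rfl
  | z => intro G hG; cases hG; rfl
  | one => intro G hG; cases hG; rfl
  | add _ _ ih1 ih2 => intro G hG; cases hG with | add h1 h2 => rw [ih1 h1, ih2 h2]
  | neg _ ih => intro G hG; cases hG with | neg h => rw [ih h]
  | mul _ _ ih1 ih2 => intro G hG; cases hG with | mul h1 h2 => rw [ih1 h1, ih2 h2]
  | inv _ _ ih => intro G hG; cases hG with | inv h _ => rw [ih h]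
  | comp _ _ _ ih1 ih2 => intro G hG; cases hG with | comp h1 h2 _ => rw [ih1 h1, ih2 h2]
  | compInv _ _ _ ih =>
    intro G hG
    cases hG with
    | compInv h _ _ => obtain rfl := ih h; rfl

end

end CFree

namespace CFree

open PowerSeries Finset

/-! ### Power series over a possibly noncommutative ring -/

section Geom

variable {R : Type*}

/-! Write `m`, `M` for the moment series of `a` under `ψ`, `φ`, and `w = z(1 + m)`. Summed over
compositions, the cumulant recurrences become `R(w) = m` and `M = (ᶜR(w)/w) z(1 + M)`
(`rTransform_subst`, `divZ_crTransform_subst`).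

These equations can be solved for `M` in terms of `T` and `ᶜT`, which is (ii). With `v` the inverse
of `m`, they also give `ᶜT = M(v) / (v(1 + M(v)))` (`ctTransform_mul_eq`).

For (iii), let `x`, `y` be the inverses of the `ψ`-moment series of `a`, `b`. The resolvents are `(1
- xa)⁻¹ = 1 + z + zp` and `(1 - yb)⁻¹ = 1 + z + zq` with `p`, `q` centered for `ψ`. With `t = (1 +
z)xy/z`, `1 - t ab = (1 - xa)(1 + z - z pq)(1 - yb)`, so inverting and expanding the middle factor
writes `(1 - t ab)⁻¹` through alternating words in `p`, `q`, on which c-freeness applies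
(`resolvent_mul`, `AreCFree.mapLin_resolvent_mul`). Under `ψ` this gives `1 + z`, so `t` inverts the
`ψ`-moment series of `ab`. Under `φ` it gives `M_ab(t)` in terms of `φ(p)`, `φ(q)`, that is, of
`M_a(x) = z(1 + φ(p))` and `M_b(y) = z(1 + φ(q))`; the formula for `ᶜT` does the rest. -/

theorem coeff_prod_ofFn [Semiring R] (n k : ℕ) (F : Fin n → R⟦X⟧) :
    coeff k (List.ofFn F).prod =
      ∑ l ∈ Nat.antidiagonalTuple n k, (List.ofFn fun j => coeff (l j) (F j)).prod := by
  induction n generalizing k with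
  | zero => cases k <;> simp [coeff_one]
  | succ n ih =>
    rw [List.ofFn_succ, List.prod_cons, coeff_mul]
    simp_rw [ih, mul_sum]
    rw [sum_sigma']
    refine sum_bij' (fun p _ => Fin.cons p.1.1 p.2)
      (fun l _ => ⟨(l 0, ∑ j, Fin.tail l j), Fin.tail l⟩) ?_ ?_ ?_ ?_ ?_
    · rintro ⟨⟨i, j⟩, l⟩ h
      simp only [mem_sigma, HasAntidiagonal.mem_antidiagonal, Nat.mem_antidiagonalTuple] at h ⊢
      rw [Fin.sum_univ_succ]
      simp [h.1, h.2]
    · intro l h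
      simp only [mem_sigma, HasAntidiagonal.mem_antidiagonal, Nat.mem_antidiagonalTuple] at h ⊢
      rw [Fin.sum_univ_succ] at h
      exact ⟨h, trivial⟩
    · rintro ⟨⟨i, j⟩, l⟩ h
      simp only [mem_sigma, HasAntidiagonal.mem_antidiagonal, Nat.mem_antidiagonalTuple] at h
      simp [h.2]
    · intro l h
      simp
    · rintro ⟨⟨i, j⟩, l⟩ h
      simp [List.ofFn_succ]

/-- The geometric series `(1 - F)⁻¹`. -/
noncomputable def geom [Ring R] (F : R⟦X⟧) : R⟦X⟧ :=
  invOfUnit (1 - F) 1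

variable [Ring R] {F : R⟦X⟧}

theorem geom_mul (hF : constantCoeff F = 0) : geom F * (1 - F) = 1 :=
  invOfUnit_mul _ _ (by simp [hF])

theorem mul_geom (hF : constantCoeff F = 0) : (1 - F) * geom F = 1 :=
  mul_invOfUnit _ _ (by simp [hF])

theorem eq_geom (hF : constantCoeff F = 0) {G : R⟦X⟧} (h : (1 - F) * G = 1) : G = geom F := by
  rw [← one_mul G, ← geom_mul hF, mul_assoc, h, mul_one]

/-- Stands in for convergence of the geometric series: the tail is divisible by `X ^ N`, hence
invisible in degrees below `N`. Centrality of `X` lets it be pulled out of `F ^ N`. -/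
theorem geom_eq_sum_add (hF : constantCoeff F = 0) (N : ℕ) :
    ∃ G, geom F = ∑ n ∈ range N, F ^ n + X ^ N * G := by
  obtain ⟨F', rfl⟩ := X_dvd_iff.2 hF
  refine ⟨F' ^ N * geom (X * F'), ?_⟩
  rw [← mul_assoc, ← (commute_X F').symm.mul_pow]
  induction N with
  | zero => simp
  | succ N ih =>
    have h1 : geom (X * F') = 1 + (X * F') * geom (X * F') := by
      rw [← sub_eq_iff_eq_add, ← mul_geom hF, sub_mul, one_mul]
    calc geom (X * F') = ∑ n ∈ range N, (X * F') ^ n + (X * F') ^ N * geom (X * F') := ih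
      _ = ∑ n ∈ range N, (X * F') ^ n + (X * F') ^ N * (1 + (X * F') * geom (X * F')) := by
        rw [← h1]
      _ = _ := by rw [sum_range_succ, mul_add, mul_one, add_assoc, pow_succ, mul_assoc _ (X * F')]

theorem coeff_geom (hF : constantCoeff F = 0) {k N : ℕ} (hk : k < N) :
    coeff k (geom F) = ∑ n ∈ range N, coeff k (F ^ n) := by
  obtain ⟨G, hG⟩ := geom_eq_sum_add hF N
  rw [hG, map_add, map_sum, coeff_X_pow_mul', if_neg (by omega), add_zero]

/-- The unit inverted is `1`, so the recursion for the coefficients of the inverse uses ring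
operations only. -/
theorem coeff_geom_mem {S : Subring R} (h : ∀ n, coeff n F ∈ S) (n : ℕ) :
    coeff n (geom F) ∈ S := by
  induction n using Nat.strong_induction_on with
  | _ n ih =>
    rw [geom, coeff_invOfUnit]
    split_ifs
    · simp [S.one_mem]
    · simp only [inv_one, Units.val_one, neg_mul, one_mul]
      refine S.neg_mem (S.sum_mem fun x _ => ?_)
      split_ifs with hx
      · refine S.mul_mem ?_ (ih _ hx)
        rw [map_sub, coeff_one]
        refine S.sub_mem ?_ (h _)
        split_ifs
        exacts [S.one_mem, S.zero_mem]
      · exact S.zero_mem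

end Geom

/-! ### Substitution and substitutional inverses -/

section Subst

variable {K : Type*} [Field K]

/-- `w ^ p` starts in degree `p`, so the sum may stop at any `N > n`. The factor `G` accommodates
the last gap of the c-free recurrence, which is weighted by `φ`. -/
theorem coeff_subst_mul (F : K⟦X⟧) {w : K⟦X⟧} (hw : constantCoeff w = 0) (G : K⟦X⟧) {n N : ℕ}
    (hN : n < N) :
    coeff n (F.subst w * G) = ∑ p ∈ range N, coeff p F * coeff n (w ^ p * G) := by
  have h0 : ∀ i < N, coeff i (F.subst w : K⟦X⟧) = ∑ p ∈ range N, coeff p F * coeff i (w ^ p) := by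
    intro i hi
    rw [coeff_subst' (HasSubst.of_constantCoeff_zero' hw), finsum_eq_sum_of_support_subset]
    · rfl
    · intro p hp
      by_contra hpN
      apply hp
      have hpN : N ≤ p := by simpa using hpN
      obtain ⟨w', rfl⟩ := X_dvd_iff.2 hw
      simp only [mul_pow, coeff_X_pow_mul', smul_eq_mul]
      rw [if_neg (by omega), mul_zero]
  simp_rw [coeff_mul, mul_sum]
  rw [sum_comm]
  refine sum_congr rfl fun x hx => ?_
  rw [h0 _ (by have := HasAntidiagonal.mem_antidiagonal.1 hx; omega), sum_mul]
  exact sum_congr rfl fun _ _ => mul_assoc _ _ _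

theorem constantCoeff_subst_zero (F : K⟦X⟧) {w : K⟦X⟧} (hw : constantCoeff w = 0) :
    constantCoeff (F.subst w : K⟦X⟧) = constantCoeff F := by
  have := coeff_subst_mul F hw 1 (n := 0) one_pos
  simpa using this

theorem coeff_one_subst (F : K⟦X⟧) {w : K⟦X⟧} (hw : constantCoeff w = 0) :
    coeff 1 (F.subst w : K⟦X⟧) = coeff 1 F * coeff 1 w := by
  have := coeff_subst_mul F hw 1 (n := 1) (N := 1 + 1) one_lt_two
  rw [mul_one, sum_range_succ, sum_range_succ, range_zero, sum_empty] at this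
  simpa [coeff_one] using this

theorem subst_one' {w : K⟦X⟧} (hw : constantCoeff w = 0) : (1 : K⟦X⟧).subst w = (1 : K⟦X⟧) := by
  rw [← coe_substAlgHom (HasSubst.of_constantCoeff_zero' hw), map_one]

theorem substInvOfIsUnit_eq {P Q : K⟦X⟧} (hP : constantCoeff P = 0) (hQ : constantCoeff Q = 0)
    (hP' : IsUnit (coeff 1 P)) (h : P.subst Q = (X : K⟦X⟧)) : P.substInvOfIsUnit hP' = Q := by
  have hQ' : HasSubst Q := HasSubst.of_constantCoeff_zero' hQ
  have hP'' : HasSubst P := HasSubst.of_constantCoeff_zero' hP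
  have := congrArg (PowerSeries.subst Q) (subst_substInvOfIsUnit_left P hP hP')
  rwa [subst_comp_subst_apply hP'' hQ', h, X_subst, subst_X hQ'] at this

end Subst

/-! ### Sums over compositions -/

/-- A product of `p` series without constant term expands over tuples of positive exponents, and
those of sum `n` are the compositions of `n` into `p` blocks. The factors may depend on `p` and `k`,
so that the last block can be treated differently. -/
theorem sum_composition_mul_coeff (K : ℕ → ℂ) (F : (p : ℕ) → Fin p → ℂ⟦X⟧)
    (hF : ∀ p k, constantCoeff (F p k) = 0) {n N : ℕ} (hN : n < N) :
    ∑ c : Composition n, K c.length * ∏ k, coeff (c.blocksFun k) (F c.length k) =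
      ∑ p ∈ range N, K p * coeff n (∏ k, F p k) := by
  have hcoeff : ∀ p, coeff n (∏ k, F p k) =
      ∑ l ∈ Nat.antidiagonalTuple p n with ∀ k, 0 < l k, ∏ k, coeff (l k) (F p k) := by
    intro p
    rw [← List.prod_ofFn, coeff_prod_ofFn, sum_filter_of_ne]
    · simp [List.prod_ofFn]
    · intro l _ hl k
      by_contra hk
      apply hl
      refine prod_eq_zero (mem_univ k) ?_
      rw [Nat.eq_zero_of_not_pos hk, coeff_zero_eq_constantCoeff_apply, hF]
  simp_rw [hcoeff, mul_sum]
  rw [sum_sigma']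
  refine sum_bij (fun c _ => ⟨c.length, c.blocksFun⟩) ?_ ?_ ?_ ?_
  · intro c _
    simp only [mem_sigma, mem_range, mem_filter, Nat.mem_antidiagonalTuple]
    exact ⟨c.length_le.trans_lt hN, c.sum_blocksFun, c.one_le_blocksFun⟩
  · intro c _ d _ h
    have h := List.ofFn_inj'.2 h
    rw [c.ofFn_blocksFun, d.ofFn_blocksFun] at h
    exact Composition.ext h
  · rintro ⟨p, l⟩ h
    simp only [mem_sigma, mem_range, mem_filter, Nat.mem_antidiagonalTuple] at h
    refine ⟨⟨List.ofFn l, ?_, ?_⟩, mem_univ _, ?_⟩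
    · intro i hi
      obtain ⟨k, rfl⟩ := (List.mem_ofFn' _ _).1 hi
      exact h.2.2 k
    · rw [List.sum_ofFn, h.2.1]
    · rw [← List.ofFn_inj', Composition.ofFn_blocksFun]
  · intro c _
    rfl

/-! ### The transforms of a single element -/

section Transforms

variable {A : Type u} [Ring A] [Algebra ℂ A] {φ ψ : A →ₗ[ℂ] ℂ}

theorem coeff_one_add_momentSeries (hφ : φ 1 = 1) (a : A) (n : ℕ) :
    coeff n (1 + momentSeries φ a) = φ (a ^ n) := by
  rw [map_add, coeff_one, momentSeries, coeff_mk]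
  split_ifs with h
  · simp [h, hφ]
  · simp

theorem constantCoeff_momentSeries (φ : A →ₗ[ℂ] ℂ) (a : A) :
    constantCoeff (momentSeries φ a) = 0 := by
  simp [momentSeries]

theorem coeff_one_momentSeries (φ : A →ₗ[ℂ] ℂ) (a : A) :
    coeff 1 (momentSeries φ a) = φ a := by
  simp [momentSeries]

theorem constantCoeff_rTransform (ψ : A →ₗ[ℂ] ℂ) (a : A) :
    constantCoeff (rTransform ψ a) = 0 := by
  simp [rTransform]

omit [Algebra ℂ A] in
theorem gap_const {n : ℕ} (c : Composition n) (a : A) (k : Fin c.length) :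
    gap c (fun _ => a) k = a ^ (c.blocksFun k - 1) := by
  simp [gap, List.ofFn_const]

/-- The weight of a block of length `n`: the factor `X` counts its head, the moment comes from its
gap of length `n - 1`. -/
theorem coeff_X_mul_one_add_momentSeries (hφ : φ 1 = 1) (a : A) {n : ℕ} (hn : 1 ≤ n) :
    coeff n (X * (1 + momentSeries φ a)) = φ (a ^ (n - 1)) := by
  obtain ⟨n, rfl⟩ := Nat.exists_eq_add_of_le' hn
  rw [coeff_succ_X_mul, coeff_one_add_momentSeries hφ, Nat.add_sub_cancel]

/-- `R_X(z (1 + m(z))) = m(z)` for the moment series `m` with respect to `ψ`. -/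
theorem rTransform_subst (hψ : ψ 1 = 1) (a : A) :
    (rTransform ψ a).subst (X * (1 + momentSeries ψ a)) = momentSeries ψ a := by
  have hw : constantCoeff (X * (1 + momentSeries ψ a)) = 0 := by simp
  ext n
  rcases Nat.eq_zero_or_pos n with rfl | hn
  · rw [coeff_zero_eq_constantCoeff_apply, coeff_zero_eq_constantCoeff_apply,
      constantCoeff_subst_zero _ hw, constantCoeff_rTransform, constantCoeff_momentSeries]
  have h := sum_composition_mul_coeff (fun p => coeff p (rTransform ψ a))
    (fun _ _ => X * (1 + momentSeries ψ a)) (fun _ _ => hw) n.lt_succ_self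
  have hrec := freeCumulant_recurrence ψ hψ n fun _ => a
  rw [← mul_one (PowerSeries.subst _ _), coeff_subst_mul _ hw _ n.lt_succ_self]
  simp only [prod_const, card_univ, Fintype.card_fin] at h
  simp only [mul_one]
  rw [← h, momentSeries, coeff_mk, if_neg hn.ne', ← List.prod_replicate, ← List.ofFn_const, hrec]
  refine sum_congr rfl fun c _ => ?_
  have hc := c.length_pos_of_pos hn
  rw [rTransform, coeff_mk, if_neg hc.ne']
  congr 1
  refine prod_congr rfl fun k _ => ?_
  rw [gap_const, ← momentSeries, coeff_X_mul_one_add_momentSeries hψ a (c.one_le_blocksFun k)]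

/-- `M_X(z) = (ᶜR_X(w) / w) z (1 + M_X(z))` with `w = z (1 + m(z))`. -/
theorem divZ_crTransform_subst (hφ : φ 1 = 1) (hψ : ψ 1 = 1) (a : A) :
    (divZ (crTransform φ ψ a)).subst (X * (1 + momentSeries ψ a)) *
      (X * (1 + momentSeries φ a)) = momentSeries φ a := by
  have hw : constantCoeff (X * (1 + momentSeries ψ a)) = 0 := by simp
  ext n
  rcases Nat.eq_zero_or_pos n with rfl | hn
  · simp [coeff_zero_eq_constantCoeff_apply, constantCoeff_momentSeries]
  -- The bound is `n + 2`: splitting off the vanishing term `p = 0` and shifting `p` turns the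
  -- coefficients of `ᶜR` into those of `ᶜR/z`, with the bound `n + 1` left.
  have h := sum_composition_mul_coeff (fun p => coeff p (crTransform φ ψ a))
    (fun p k => if (k : ℕ) + 1 = p then X * (1 + momentSeries φ a)
      else X * (1 + momentSeries ψ a)) (fun p k => by split_ifs <;> simp)
    (n.lt_succ_self.trans (n + 1).lt_succ_self)
  have hrec := cfreeCumulant_recurrence φ ψ hφ hψ n fun _ => a
  rw [coeff_subst_mul _ hw _ n.lt_succ_self]
  have hlast : ∀ p : ℕ, (∏ k : Fin (p + 1), if (k : ℕ) + 1 = p + 1 then X * (1 + momentSeries φ a)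
      else X * (1 + momentSeries ψ a)) =
        (X * (1 + momentSeries ψ a)) ^ p * (X * (1 + momentSeries φ a)) := by
    intro p
    rw [Fin.prod_univ_castSucc]
    congr 1
    · rw [prod_congr rfl fun k _ => if_neg _, prod_const, card_univ, Fintype.card_fin]
      intro k _
      have := k.2
      simp only [Fin.val_castSucc]
      omega
    · simp
  rw [sum_range_succ'] at h
  simp only [hlast, univ_eq_empty, prod_empty, coeff_one, hn.ne', if_false, mul_zero,
    add_zero] at h
  simp only [divZ, coeff_mk]
  rw [← h, momentSeries, coeff_mk, if_neg hn.ne', ← List.prod_replicate, ← List.ofFn_const, hrec]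
  refine sum_congr rfl fun c _ => ?_
  have hc := c.length_pos_of_pos hn
  rw [crTransform, coeff_mk, if_neg hc.ne']
  congr 1
  refine prod_congr rfl fun k _ => ?_
  rw [gap_const, ← momentSeries]
  split_ifs
  · rw [coeff_X_mul_one_add_momentSeries hφ a (c.one_le_blocksFun k)]
  · rw [coeff_X_mul_one_add_momentSeries hψ a (c.one_le_blocksFun k)]

theorem constantCoeff_rTransformInv {a : A} (ha : ψ a ≠ 0) :
    constantCoeff (rTransformInv ψ a ha) = 0 := by
  simp [rTransformInv]

theorem rTransform_subst_rTransformInv {a : A} (ha : ψ a ≠ 0) :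
    (rTransform ψ a).subst (rTransformInv ψ a ha) = (X : ℂ⟦X⟧) :=
  subst_substInvOfIsUnit_right _ (constantCoeff_rTransform ψ a) _

theorem rTransformInv_subst_rTransform {a : A} (ha : ψ a ≠ 0) :
    (rTransformInv ψ a ha).subst (rTransform ψ a) = (X : ℂ⟦X⟧) :=
  subst_substInvOfIsUnit_left _ (constantCoeff_rTransform ψ a) _

theorem X_mul_divZ {F : ℂ⟦X⟧} (hF : constantCoeff F = 0) : X * divZ F = F := by
  have := sub_const_eq_X_mul_shift F
  rw [hF, map_zero, sub_zero] at this
  exact this.symm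

/-- Obtained by substituting `R⁻¹` into `R = z · (R/z)`; it recovers `R⁻¹` as `z/T`. -/
theorem rTransformInv_mul_tTransform {a : A} (ha : ψ a ≠ 0) :
    rTransformInv ψ a ha * tTransform ψ a ha = X := by
  have h := HasSubst.of_constantCoeff_zero' (constantCoeff_rTransformInv ha)
  have := rTransform_subst_rTransformInv ha
  rwa [← X_mul_divZ (constantCoeff_rTransform ψ a), subst_mul h, subst_X h] at this

theorem constantCoeff_tTransform {a : A} (ha : ψ a ≠ 0) :
    constantCoeff (tTransform ψ a ha) = ψ a := by
  rw [tTransform, constantCoeff_subst_zero _ (constantCoeff_rTransformInv ha), divZ,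
    constantCoeff_mk, zero_add, coeff_one_rTransform]

/-- `ᶜT_X ∘ R_X = ᶜR_X(z) / z`. -/
theorem ctTransform_subst_rTransform {a : A} (ha : ψ a ≠ 0) :
    (ctTransform φ ψ a ha).subst (rTransform ψ a) = divZ (crTransform φ ψ a) := by
  rw [ctTransform, subst_comp_subst_apply
    (HasSubst.of_constantCoeff_zero' (constantCoeff_rTransformInv ha))
    (HasSubst.of_constantCoeff_zero' (constantCoeff_rTransform ψ a)),
    rTransformInv_subst_rTransform, X_subst]

/-- If `v` is the substitutional inverse of the moment series with respect to `ψ`, then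
`ᶜT_X · v · (1 + M_X(v)) = M_X(v)`. -/
theorem ctTransform_mul_eq (hφ : φ 1 = 1) (hψ : ψ 1 = 1) {a : A} (ha : ψ a ≠ 0) {v : ℂ⟦X⟧}
    (hv : constantCoeff v = 0) (hmv : (momentSeries ψ a).subst v = (X : ℂ⟦X⟧)) :
    ctTransform φ ψ a ha * (v * (1 + (momentSeries φ a).subst v)) =
      (momentSeries φ a).subst v := by
  have hs := HasSubst.of_constantCoeff_zero' hv
  have hw : HasSubst (X * (1 + momentSeries ψ a)) := HasSubst.of_constantCoeff_zero' (by simp)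
  -- `R(w(v)) = m(v) = z`, and the substitutional inverse is unique.
  have hwv : (X * (1 + momentSeries ψ a)).subst v = rTransformInv ψ a ha := by
    refine (substInvOfIsUnit_eq (constantCoeff_rTransform ψ a) ?_ _ ?_).symm
    · rw [constantCoeff_subst_zero _ hv]
      simp
    · rw [← subst_comp_subst_apply hw hs, rTransform_subst hψ, hmv]
  have h := congrArg (PowerSeries.subst v) (divZ_crTransform_subst hφ hψ a)
  rwa [subst_mul hs, subst_comp_subst_apply hw hs, hwv, subst_mul hs, subst_X hs,
    subst_add hs, subst_one' hv, ← ctTransform] at h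

end Transforms

/-! ### Recovering the moments -/

/-- The expression recovering `M_X` from `T_X` and `ᶜT_X`. -/
def momentExpr : SeriesExpr :=
  -- `r` is `R`, as `z/T = R⁻¹`; `w` is `z(1 + m)`, as `w/(1 + R(w)) = z`. Then `r ∘ w` is `m`, and
  -- `ᶜT(m) = ᶜT(R(w)) = ᶜR(w)/w`, so `M = d(1 + M)`.
  let r := SeriesExpr.compInv (.mul .z (.inv .fst))
  let w := SeriesExpr.compInv (.mul .z (.inv (.add .one r)))
  let d := SeriesExpr.mul .z (.comp .snd (.comp r w))
  .mul d (.inv (.add .one (.neg d)))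

theorem evaluates_momentExpr {A : Type u} [Ring A] [Algebra ℂ A] {φ ψ : A →ₗ[ℂ] ℂ}
    (hφ : φ 1 = 1) (hψ : ψ 1 = 1) {a : A} (ha : ψ a ≠ 0) :
    Evaluates (tTransform ψ a ha) (ctTransform φ ψ a ha) momentExpr (momentSeries φ a) := by
  have hT : constantCoeff (tTransform ψ a ha) ≠ 0 := by rwa [constantCoeff_tTransform]
  have hR0 := constantCoeff_rTransform ψ a
  have hRi : X * (tTransform ψ a ha)⁻¹ = rTransformInv ψ a ha := by
    rw [← rTransformInv_mul_tTransform ha, mul_assoc, PowerSeries.mul_inv_cancel _ hT, mul_one]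
  have hr : Evaluates (tTransform ψ a ha) (ctTransform φ ψ a ha)
      (.compInv (.mul .z (.inv .fst))) (rTransform ψ a) := by
    have hu : IsUnit (coeff 1 (X * (tTransform ψ a ha)⁻¹)) := by
      rw [coeff_succ_X_mul, coeff_zero_eq_constantCoeff_apply, constantCoeff_inv]
      exact (inv_ne_zero hT).isUnit
    have := Evaluates.compInv (Q := ctTransform φ ψ a ha) (.mul .z (.inv .fst hT)) (by simp) hu
    rwa [substInvOfIsUnit_eq (by simp) hR0 _
      (by rw [hRi, rTransformInv_subst_rTransform])] at this
  have hw0 : constantCoeff (X * (1 + momentSeries ψ a)) = 0 := by simp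
  have hws := HasSubst.of_constantCoeff_zero' hw0
  have h1 : constantCoeff (1 + rTransform ψ a) ≠ 0 := by simp [hR0]
  have hw : Evaluates (tTransform ψ a ha) (ctTransform φ ψ a ha)
      (.compInv (.mul .z (.inv (.add .one (.compInv (.mul .z (.inv .fst)))))))
      (X * (1 + momentSeries ψ a)) := by
    have hu : IsUnit (coeff 1 (X * (1 + rTransform ψ a)⁻¹)) := by
      rw [coeff_succ_X_mul, coeff_zero_eq_constantCoeff_apply, constantCoeff_inv]
      exact (inv_ne_zero h1).isUnit
    have := Evaluates.compInv (.mul .z (.inv (.add .one hr) h1)) (by simp) hu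
    rwa [substInvOfIsUnit_eq (by simp) hw0] at this
    have h2 := congrArg (PowerSeries.subst (X * (1 + momentSeries ψ a)))
      (PowerSeries.mul_inv_cancel _ h1)
    rw [subst_mul hws, subst_add hws, subst_one' hw0, rTransform_subst hψ] at h2
    rw [subst_mul hws, subst_X hws, mul_assoc, h2, mul_one]
  have hrw := Evaluates.comp hr hw hw0
  rw [rTransform_subst hψ] at hrw
  have hd := Evaluates.mul .z (Evaluates.comp .snd hrw (constantCoeff_momentSeries ψ a))
  have hd0 : constantCoeff (1 + -(X * (ctTransform φ ψ a ha).subst (momentSeries ψ a))) ≠ 0 := by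
    simp
  have := Evaluates.mul hd (.inv (.add .one (.neg hd)) hd0)
  suffices h : momentSeries φ a =
      X * (ctTransform φ ψ a ha).subst (momentSeries ψ a) *
        (1 + -(X * (ctTransform φ ψ a ha).subst (momentSeries ψ a)))⁻¹ by
    rw [← h] at this
    exact this
  rw [PowerSeries.eq_mul_inv_iff_mul_eq hd0]
  have h3 := divZ_crTransform_subst hφ hψ a
  rw [← ctTransform_subst_rTransform ha,
    subst_comp_subst_apply (HasSubst.of_constantCoeff_zero' hR0) hws, rTransform_subst hψ] at h3
  linear_combination -h3

/-! ### Power series with coefficients in the algebra -/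

section Words

variable {A : Type u} [Ring A] [Algebra ℂ A] {φ ψ : A →ₗ[ℂ] ℂ}

/-- The coefficientwise extension of a linear functional to power series. -/
noncomputable def mapLin (φ : A →ₗ[ℂ] ℂ) : A⟦X⟧ →+ ℂ⟦X⟧ where
  toFun F := PowerSeries.mk fun n => φ (coeff n F)
  map_zero' := by ext; simp
  map_add' F G := by ext; simp

@[simp]
theorem coeff_mapLin (φ : A →ₗ[ℂ] ℂ) (F : A⟦X⟧) (n : ℕ) :
    coeff n (mapLin φ F) = φ (coeff n F) :=
  coeff_mk n fun n => φ (coeff n F)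

/-- Complex power series, as central elements of the power series over `A`. -/
noncomputable def scalar (A : Type u) [Ring A] [Algebra ℂ A] : ℂ⟦X⟧ →+* A⟦X⟧ :=
  PowerSeries.map (algebraMap ℂ A)

theorem coeff_scalar (s : ℂ⟦X⟧) (n : ℕ) : coeff n (scalar A s) = algebraMap ℂ A (coeff n s) :=
  coeff_map _ _ _

theorem scalar_X : scalar A X = X :=
  map_X _

theorem scalar_commute (s : ℂ⟦X⟧) (F : A⟦X⟧) : Commute (scalar A s) F := by
  ext n
  rw [coeff_mul, coeff_mul, ← Finset.Nat.sum_antidiagonal_swap]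
  exact sum_congr rfl fun x _ => by
    rw [coeff_scalar]
    exact Algebra.commutes _ _

theorem mapLin_scalar_mul (φ : A →ₗ[ℂ] ℂ) (s : ℂ⟦X⟧) (F : A⟦X⟧) :
    mapLin φ (scalar A s * F) = s * mapLin φ F := by
  ext n
  rw [coeff_mapLin, coeff_mul, coeff_mul, map_sum]
  refine sum_congr rfl fun x _ => ?_
  rw [coeff_scalar, ← Algebra.smul_def, map_smul, coeff_mapLin, smul_eq_mul]

theorem mapLin_one (hφ : φ 1 = 1) : mapLin φ 1 = 1 := by
  ext n
  rw [coeff_mapLin, coeff_one, coeff_one]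
  split_ifs <;> simp [hφ]

theorem mapLin_scalar (hφ : φ 1 = 1) (s : ℂ⟦X⟧) : mapLin φ (scalar A s) = s := by
  rw [← mul_one (scalar A s), mapLin_scalar_mul, mapLin_one hφ, mul_one]

/-- The resolvent `(1 - v a)⁻¹` for a complex power series `v` without constant term. -/
noncomputable def resolvent (v : ℂ⟦X⟧) (a : A) : A⟦X⟧ :=
  geom (scalar A v * C a)

theorem constantCoeff_scalar_mul {v : ℂ⟦X⟧} (hv : constantCoeff v = 0) (F : A⟦X⟧) :
    constantCoeff (scalar A v * F) = 0 := by
  rw [map_mul, ← coeff_zero_eq_constantCoeff_apply (scalar A v), coeff_scalar,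
    coeff_zero_eq_constantCoeff_apply, hv, map_zero, zero_mul]

/-- Since `v` is central, `(va)^n = v^n a^n`, and `φ` acts term by term. -/
theorem mapLin_resolvent (hφ : φ 1 = 1) {v : ℂ⟦X⟧} (hv : constantCoeff v = 0) (a : A) :
    mapLin φ (resolvent v a) = 1 + (momentSeries φ a).subst v := by
  have : 1 + (momentSeries φ a).subst v = ((1 + momentSeries φ a).subst v : ℂ⟦X⟧) := by
    rw [subst_add (HasSubst.of_constantCoeff_zero' hv), subst_one' hv]
  rw [this, ← mul_one (PowerSeries.subst _ _)]
  ext k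
  rw [coeff_subst_mul _ hv _ k.lt_succ_self, coeff_mapLin, resolvent,
    coeff_geom (constantCoeff_scalar_mul hv _) k.lt_succ_self, map_sum]
  refine sum_congr rfl fun n _ => ?_
  rw [(scalar_commute v _).mul_pow, ← map_pow, ← map_pow, coeff_mul_C, coeff_scalar,
    ← Algebra.smul_def, map_smul, coeff_one_add_momentSeries hφ, mul_one, smul_eq_mul, mul_comm]

theorem coeff_resolvent_mem (v : ℂ⟦X⟧) (a : A) (n : ℕ) :
    coeff n (resolvent v a) ∈ Algebra.adjoin ℂ {a} := by
  refine coeff_geom_mem (S := (Algebra.adjoin ℂ {a}).toSubring) (fun n => ?_) n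
  rw [coeff_mul_C, coeff_scalar]
  exact mul_mem (Subalgebra.algebraMap_mem _ _) (Algebra.self_mem_adjoin_singleton ℂ a)

/-- Lets every statement about `φ` be reused for `ψ`: on centered factors the product of the
`ψ`-values is zero as well. -/
theorem IsCFree.self {ι : Type*} {S : ι → Subalgebra ℂ A} (h : IsCFree φ ψ S) :
    IsCFree ψ ψ S := by
  intro n ε a hS hε hψ
  have h0 := (h n ε a hS hε hψ).1
  refine ⟨h0, ?_⟩
  rw [h0, prod_eq_zero (mem_univ 0) (hψ 0)]

/-- By multilinearity: each coefficient of the product is a sum of alternating products of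
coefficients, and these are all centered. -/
theorem IsCFree.mapLin_prod {ι : Type*} {S : ι → Subalgebra ℂ A} (h : IsCFree φ ψ S) {n : ℕ}
    (ε : Fin (n + 1) → ι) (F : Fin (n + 1) → A⟦X⟧) (hS : ∀ j k, coeff k (F j) ∈ S (ε j))
    (hε : ∀ j : Fin n, ε j.castSucc ≠ ε j.succ) (hψ : ∀ j, mapLin ψ (F j) = 0) :
    mapLin φ (List.ofFn F).prod = ∏ j, mapLin φ (F j) := by
  ext k
  rw [coeff_mapLin, coeff_prod_ofFn, map_sum, ← List.prod_ofFn, coeff_prod_ofFn]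
  refine sum_congr rfl fun l _ => ?_
  rw [(h n ε _ (fun j => hS j (l j)) hε fun j => ?_).2, List.prod_ofFn]
  · simp
  · rw [← coeff_mapLin, hψ, map_zero]

/-- The alternating word `p q p q ...` of length `n`. -/
def altWord {M : Type*} [Monoid M] (p q : M) (n : ℕ) : M :=
  (List.ofFn fun j : Fin n => if Even (j : ℕ) then p else q).prod

theorem altWord_succ {M : Type*} [Monoid M] (p q : M) (n : ℕ) :
    altWord p q (n + 1) = p * altWord q p n := by
  rw [altWord, List.ofFn_succ, List.prod_cons, altWord]
  simp only [Fin.val_zero, Even.zero, if_true, Fin.val_succ, Nat.even_add_one, ite_not]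

theorem altWord_two_mul {M : Type*} [Monoid M] (p q : M) (n : ℕ) :
    altWord p q (2 * n) = (p * q) ^ n := by
  induction n with
  | zero => simp [altWord]
  | succ n ih => rw [mul_add_one, altWord_succ, altWord_succ, ih, pow_succ', mul_assoc]

theorem AreCFree.mapLin_altWord {a b : A} (h : AreCFree φ ψ a b) (hφ : φ 1 = 1) {p q : A⟦X⟧}
    {i j : Fin 2} (hij : i ≠ j)
    (hp : ∀ n, coeff n p ∈ Algebra.adjoin ℂ {![a, b] i})
    (hq : ∀ n, coeff n q ∈ Algebra.adjoin ℂ {![a, b] j})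
    (hp0 : mapLin ψ p = 0) (hq0 : mapLin ψ q = 0) (n : ℕ) :
    mapLin φ (altWord p q n) = altWord (mapLin φ p) (mapLin φ q) n := by
  cases n with
  | zero => simp [altWord, mapLin_one hφ]
  | succ n =>
    rw [altWord, altWord, List.prod_ofFn,
      IsCFree.mapLin_prod h (fun k : Fin (n + 1) => if Even (k : ℕ) then i else j)]
    · exact prod_congr rfl fun k _ => by split_ifs <;> rfl
    · intro k m
      split_ifs
      exacts [hp m, hq m]
    · intro k
      simp only [Fin.val_castSucc, Fin.val_succ, Nat.even_add_one, ite_not]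
      split_ifs
      exacts [hij, hij.symm]
    · intro k
      split_ifs
      exacts [hp0, hq0]

theorem AreCFree.self {a b : A} (h : AreCFree φ ψ a b) : AreCFree ψ ψ a b :=
  IsCFree.self h

/-- If `p` and `q` are centered with coefficients in the algebras generated by `a` and `b`, then
`φ ((s + u q) (p q)^n (s + u p))` factorizes, where `u` is the variable. -/
theorem AreCFree.mapLin_mul_pow_mul {a b : A} (h : AreCFree φ ψ a b) (hφ : φ 1 = 1) {p q : A⟦X⟧}
    (hp : ∀ n, coeff n p ∈ Algebra.adjoin ℂ {a}) (hq : ∀ n, coeff n q ∈ Algebra.adjoin ℂ {b})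
    (hp0 : mapLin ψ p = 0) (hq0 : mapLin ψ q = 0) (s r : ℂ⟦X⟧) (n : ℕ) :
    mapLin φ ((scalar A s + scalar A r * q) * (p * q) ^ n * (scalar A s + scalar A r * p)) =
      (s + r * mapLin φ q) * (s + r * mapLin φ p) * (mapLin φ p * mapLin φ q) ^ n := by
  have hpq := h.mapLin_altWord hφ (i := 0) (j := 1) (by decide) hp hq hp0 hq0
  have hqp := h.mapLin_altWord hφ (i := 1) (j := 0) (by decide) hq hp hq0 hp0
  -- Both outer factors attach to `(pq)^n` without breaking alternation, leaving four alternating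
  -- words of lengths `2n`, `2n + 1` (twice) and `2n + 2`.
  have e1 : (scalar A s + scalar A r * q) * (p * q) ^ n * (scalar A s + scalar A r * p) =
      scalar A (s * s) * altWord p q (2 * n) + scalar A (s * r) * altWord p q (2 * n + 1) +
        scalar A (s * r) * altWord q p (2 * n + 1) +
          scalar A (r * r) * altWord q p (2 * (n + 1)) := by
    have hmid : altWord p q (2 * n + 1) = (p * q) ^ n * p := by
      rw [altWord_succ, altWord_two_mul, mul_pow_mul]
    have h3 : altWord q p (2 * (n + 1)) = q * ((p * q) ^ n * p) := by
      rw [mul_add_one, altWord_succ, hmid]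
    have h4 : altWord q p (2 * n + 1) = q * (p * q) ^ n := by
      rw [altWord_succ, altWord_two_mul]
    have hrs : scalar A r * scalar A s = scalar A s * scalar A r := scalar_commute r _
    rw [h3, h4, altWord_two_mul, hmid, mul_add _ (scalar A s), ← mul_assoc _ (scalar A r) p,
      ← (scalar_commute s ((scalar A s + scalar A r * q) * (p * q) ^ n)).eq,
      ← (scalar_commute r ((scalar A s + scalar A r * q) * (p * q) ^ n)).eq]
    simp only [map_mul, add_mul, mul_add, ← mul_assoc, hrs]
    abel
  rw [e1]
  simp only [map_add, mapLin_scalar_mul, hpq, hqp]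
  simp only [altWord_succ, altWord_two_mul]
  ring

end Words

/-! ### Multiplicativity -/

section Multiplicative

variable {A : Type u} [Ring A] [Algebra ℂ A] {φ ψ : A →ₗ[ℂ] ℂ}

/-- Termwise evaluation needs no continuity of `φ`: the coefficient of degree `k` sees only the
terms `n ≤ k` of either geometric series. -/
theorem mapLin_mul_geom_mul {e F G : A⟦X⟧} {η β : ℂ⟦X⟧} (he : constantCoeff e = 0)
    (hη : constantCoeff η = 0) (h : ∀ n, mapLin φ (F * e ^ n * G) = β * η ^ n) :
    mapLin φ (F * geom e * G) = β * geom η := by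
  ext k
  obtain ⟨E, hE⟩ := geom_eq_sum_add he (k + 1)
  obtain ⟨H, hH⟩ := geom_eq_sum_add hη (k + 1)
  have hX : F * (X ^ (k + 1) * E) * G = scalar A (X ^ (k + 1)) * (F * E * G) := by
    rw [map_pow, scalar_X, ← mul_assoc F, ← X_pow_mul, mul_assoc (X ^ (k + 1)), mul_assoc]
  have hX' : β * (X ^ (k + 1) * H) = X ^ (k + 1) * (β * H) := by ring
  rw [hE, hH, mul_add, add_mul, mul_add, map_add, hX, hX', mapLin_scalar_mul, map_add, map_add,
    coeff_X_pow_mul', coeff_X_pow_mul', mul_sum, sum_mul, mul_sum, map_sum]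
  simp only [h]
  simp

/-- The factorization of the resolvent of a product. -/
theorem resolvent_mul {x y t : ℂ⟦X⟧} (hx : constantCoeff x = 0) (hy : constantCoeff y = 0)
    (ht : constantCoeff t = 0) (hxyt : X * t = (1 + X) * (x * y)) {a b : A} {p q : A⟦X⟧}
    (hp : resolvent x a = scalar A (1 + X) + X * p)
    (hq : resolvent y b = scalar A (1 + X) + X * q) :
    resolvent t (a * b) = scalar A (1 + X)⁻¹ *
      (resolvent y b * geom (scalar A (X * (1 + X)⁻¹) * (p * q)) * resolvent x a) := by
  symm
  refine eq_geom (constantCoeff_scalar_mul ht _) ?_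
  have hs : (1 + X : ℂ⟦X⟧) * (1 + X)⁻¹ = 1 := PowerSeries.mul_inv_cancel _ (by simp)
  set e := scalar A (X * (1 + X)⁻¹) * (p * q) with he
  have he0 : constantCoeff e = 0 := constantCoeff_scalar_mul (by simp) _
  set P := scalar A x * C a
  set Q := scalar A y * C b
  have hP := mul_geom (constantCoeff_scalar_mul hx (C a))
  have hQ := geom_mul (constantCoeff_scalar_mul hy (C b))
  have hQ' := mul_geom (constantCoeff_scalar_mul hy (C b))
  have hs' : scalar A (1 + X) = 1 + X := by rw [map_add, map_one, scalar_X]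
  have hXP : (X : A⟦X⟧) * P = P * X := X_mul
  have hXp : (1 - P) * (X * p) = (1 + X) * P - X := by
    have h1 : (1 - P) * (1 + X + X * p) = 1 := by rw [← hs', ← hp]; exact hP
    rw [mul_add] at h1
    rw [eq_sub_of_add_eq' h1]
    simp only [mul_add, sub_mul, add_mul, one_mul, mul_one, hXP]
    abel
  have hXq : (X * q) * (1 - Q) = (1 + X) * Q - X := by
    have h1 : (1 + X + X * q) * (1 - Q) = 1 := by rw [← hs', ← hq]; exact hQ
    rw [add_mul] at h1
    rw [eq_sub_of_add_eq' h1]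
    simp only [mul_sub, add_mul, one_mul, mul_one]
    abel
  have hse : scalar A (1 + X) * (1 - e) = 1 + X - X * (p * q) := by
    rw [mul_sub, mul_one, he, ← mul_assoc, ← map_mul, mul_left_comm, hs, mul_one, hs', scalar_X]
  have hT : X * (scalar A t * C (a * b)) = (1 + X) * (P * Q) := by
    have h1 : C a * scalar A y = scalar A y * C a := (scalar_commute y _).eq.symm
    rw [← mul_assoc, ← scalar_X, ← map_mul, hxyt, map_mul, map_mul, map_mul, scalar_X, hs']
    simp only [P, Q, mul_assoc]
    rw [← mul_assoc (C a) (scalar A y), h1, mul_assoc]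
  -- Multiplied by `X`, both sides equal `X - (1 + X) P Q`; on the right `hXp` and `hXq` absorb the
  -- outer factors into `p` and `q`.
  have key : 1 - scalar A t * C (a * b) =
      (1 - P) * (scalar A (1 + X) * (1 - e)) * (1 - Q) := by
    refine X_mul_cancel ?_
    have h1 : X * ((1 - P) * (X * (p * q)) * (1 - Q)) =
        ((1 + X) * P - X) * ((1 + X) * Q - X) := by
      rw [← hXp, ← hXq]
      simp only [mul_assoc]
      rw [← mul_assoc p X, ← X_mul, ← mul_assoc X (1 - P), X_mul]
      simp only [mul_assoc]
    rw [mul_sub, mul_one, hT, hse, mul_sub (1 - P), sub_mul _ _ (1 - Q), mul_sub X (_ * _), h1]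
    have hPX : P * X = X * P := hXP.symm
    have hPX' (F : A⟦X⟧) : P * (X * F) = X * (P * F) := by
      rw [← mul_assoc, hPX, mul_assoc]
    simp only [mul_add, mul_sub, add_mul, sub_mul, one_mul, mul_one, mul_assoc, hPX, hPX']
    abel
  rw [key]
  have hc1 := scalar_commute (A := A) (1 + X)⁻¹ (1 - Q)
  have hc2 := scalar_commute (A := A) (1 + X)⁻¹ (1 - e)
  calc _ = (1 - P) * (scalar A (1 + X) * (1 - e)) * ((1 - Q) * scalar A (1 + X)⁻¹) *
        resolvent y b * geom e * resolvent x a := by simp only [mul_assoc]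
    _ = (1 - P) * scalar A (1 + X) * ((1 - e) * scalar A (1 + X)⁻¹) * ((1 - Q) *
        resolvent y b) * geom e * resolvent x a := by rw [← hc1.eq]; simp only [mul_assoc]
    _ = (1 - P) * (scalar A (1 + X) * scalar A (1 + X)⁻¹) * ((1 - e) * geom e) *
        resolvent x a := by
      rw [← hc2.eq, resolvent, hQ']; simp only [mul_assoc, one_mul]
    _ = 1 := by
      rw [← map_mul, hs, map_one, mul_geom he0, mul_one, mul_one]
      exact hP

/-- The middle factor in `resolvent_mul` is expanded; `φ` factorizes on each term, and the values
resum to a geometric series in `φ(p) φ(q)`. Denominators are cleared. -/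
theorem AreCFree.mapLin_resolvent_mul {a b : A} (h : AreCFree φ ψ a b) (hφ : φ 1 = 1)
    {x y t : ℂ⟦X⟧} (hx : constantCoeff x = 0) (hy : constantCoeff y = 0)
    (ht : constantCoeff t = 0) (hxyt : X * t = (1 + X) * (x * y)) {p q : A⟦X⟧}
    (hp : resolvent x a = scalar A (1 + X) + X * p)
    (hq : resolvent y b = scalar A (1 + X) + X * q)
    (hpa : ∀ n, coeff n p ∈ Algebra.adjoin ℂ {a}) (hqb : ∀ n, coeff n q ∈ Algebra.adjoin ℂ {b})
    (hp0 : mapLin ψ p = 0) (hq0 : mapLin ψ q = 0) :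
    (1 + X - X * (mapLin φ p * mapLin φ q)) * mapLin φ (resolvent t (a * b)) =
      (1 + X + X * mapLin φ p) * (1 + X + X * mapLin φ q) := by
  have hs : (1 + X : ℂ⟦X⟧) * (1 + X)⁻¹ = 1 := PowerSeries.mul_inv_cancel _ (by simp)
  have hη : constantCoeff (X * (1 + X)⁻¹ * (mapLin φ p * mapLin φ q)) = 0 := by simp
  rw [resolvent_mul hx hy ht hxyt hp hq, mapLin_scalar_mul,
    mapLin_mul_geom_mul (constantCoeff_scalar_mul (by simp) _) hη
      (β := (1 + X + X * mapLin φ q) * (1 + X + X * mapLin φ p))]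
  · have := mul_geom hη
    generalize geom (X * (1 + X)⁻¹ * (mapLin φ p * mapLin φ q)) = g at *
    generalize (1 + X : ℂ⟦X⟧)⁻¹ = r at *
    linear_combination ((1 + X + X * mapLin φ q) * (1 + X + X * mapLin φ p)) * (this + g * hs)
  · intro n
    have := h.mapLin_mul_pow_mul hφ hpa hqb hp0 hq0 (1 + X) X n
    rw [scalar_X, ← hp, ← hq] at this
    rw [(scalar_commute _ _).mul_pow, ← map_pow, ← mul_assoc,
      ← (scalar_commute _ (resolvent y b)).eq, mul_assoc, mul_assoc, ← mul_assoc (resolvent y b),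
      mapLin_scalar_mul, this, mul_pow (X * _)]
    ring

/-- The resolvent at the inverse of the `ψ`-moment series, split into its `ψ`-mean and a centered
part. -/
theorem exists_resolvent_eq (hψ : ψ 1 = 1) {a : A} {v : ℂ⟦X⟧} (hv : constantCoeff v = 0)
    (hmv : (momentSeries ψ a).subst v = (X : ℂ⟦X⟧)) :
    ∃ p : A⟦X⟧, resolvent v a = scalar A (1 + X) + X * p ∧
      (∀ n, coeff n p ∈ Algebra.adjoin ℂ {a}) ∧ mapLin ψ p = 0 := by
  -- Both constant terms are `1`, so the centered part is divisible by `X`; this keeps the middle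
  -- factor of `resolvent_mul` free of denominators `X`.
  have h0 : constantCoeff (resolvent v a - scalar A (1 + X)) = 0 := by
    rw [map_sub, ← coeff_zero_eq_constantCoeff_apply (scalar A _), coeff_scalar, resolvent,
      ← coeff_zero_eq_constantCoeff_apply, coeff_geom (constantCoeff_scalar_mul hv _) one_pos]
    simp
  obtain ⟨p, hp⟩ := X_dvd_iff.2 h0
  refine ⟨p, ?_, fun n => ?_, ?_⟩
  · rw [← hp, add_sub_cancel]
  · rw [← coeff_succ_X_mul, ← hp, map_sub, coeff_scalar]
    exact sub_mem (coeff_resolvent_mem v a _) (Subalgebra.algebraMap_mem _ _)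
  · have h1 := congrArg (mapLin ψ) hp
    rw [map_sub, mapLin_resolvent hψ hv, hmv, mapLin_scalar hψ, sub_self, ← scalar_X,
      mapLin_scalar_mul] at h1
    exact (mul_eq_zero.1 h1.symm).resolve_left X_ne_zero

theorem exists_momentSeries_subst_eq_X {a : A} (ha : ψ a ≠ 0) :
    ∃ v : ℂ⟦X⟧, constantCoeff v = 0 ∧ (momentSeries ψ a).subst v = (X : ℂ⟦X⟧) := by
  have hu : IsUnit (coeff 1 (momentSeries ψ a)) := by
    rw [coeff_one_momentSeries]
    exact ha.isUnit
  exact ⟨_, constantCoeff_substInvOfIsUnit _ hu,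
    subst_substInvOfIsUnit_right _ (constantCoeff_momentSeries ψ a) hu⟩

theorem AreCFree.ctTransform_mul {a b : A} (h : AreCFree φ ψ a b) (hφ : φ 1 = 1) (hψ : ψ 1 = 1)
    (ha : ψ a ≠ 0) (hb : ψ b ≠ 0) :
    ∃ hab : ψ (a * b) ≠ 0,
      ctTransform φ ψ (a * b) hab = ctTransform φ ψ a ha * ctTransform φ ψ b hb := by
  obtain ⟨x, hx, hmx⟩ := exists_momentSeries_subst_eq_X ha
  obtain ⟨y, hy, hmy⟩ := exists_momentSeries_subst_eq_X hb
  obtain ⟨p, hp, hpa, hp0⟩ := exists_resolvent_eq hψ hx hmx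
  obtain ⟨q, hq, hqb, hq0⟩ := exists_resolvent_eq hψ hy hmy
  obtain ⟨x', hx'⟩ := X_dvd_iff.2 hx
  -- This is `(1 + X) x y / X`, the division being carried out in `x`.
  set t : ℂ⟦X⟧ := (1 + X) * (x' * y) with ht
  have ht0 : constantCoeff t = 0 := by simp [ht, hy]
  have hxyt : X * t = (1 + X) * (x * y) := by rw [hx', ht]; ring
  -- The case `φ = ψ`: both means of `p` and `q` vanish, leaving `1 + m_ab(t) = 1 + X`.
  have hmt : (momentSeries ψ (a * b)).subst t = (X : ℂ⟦X⟧) := by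
    have := h.self.mapLin_resolvent_mul hψ hx hy ht0 hxyt hp hq hpa hqb hp0 hq0
    rw [hp0, hq0, mapLin_resolvent hψ ht0] at this
    have hs : (1 + X : ℂ⟦X⟧) ≠ 0 := fun h => by
      have := congrArg constantCoeff h
      simp at this
    refine mul_left_cancel₀ hs ?_
    linear_combination this
  -- The linear coefficient of `m_ab(t) = X` is `ψ(ab)` times that of `t`.
  have hab : ψ (a * b) ≠ 0 := by
    intro h0
    have := coeff_one_subst (momentSeries ψ (a * b)) ht0
    rw [hmt, coeff_one_momentSeries, h0, coeff_one_X, zero_mul] at this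
    exact one_ne_zero this
  refine ⟨hab, ?_⟩
  have hx1 := ctTransform_mul_eq hφ hψ ha hx hmx
  have hy1 := ctTransform_mul_eq hφ hψ hb hy hmy
  have ht1 := ctTransform_mul_eq hφ hψ hab ht0 hmt
  have hγ := h.mapLin_resolvent_mul hφ hx hy ht0 hxyt hp hq hpa hqb hp0 hq0
  have hα := mapLin_resolvent hφ hx a
  have hβ := mapLin_resolvent hφ hy b
  rw [hp, map_add, mapLin_scalar hφ, ← scalar_X (A := A), mapLin_scalar_mul] at hα
  rw [hq, map_add, mapLin_scalar hφ, ← scalar_X (A := A), mapLin_scalar_mul] at hβ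
  rw [mapLin_resolvent hφ ht0] at hγ
  have hne : ∀ (c : A) {v : ℂ⟦X⟧}, constantCoeff v = 0 →
      (1 + (momentSeries φ c).subst v : ℂ⟦X⟧) ≠ 0 := by
    intro c v hv h0
    have := congrArg constantCoeff h0
    rw [map_add, constantCoeff_subst_zero _ hv, constantCoeff_momentSeries] at this
    simp at this
  have hx2 := hne a hx
  have hy2 := hne b hy
  have ht2 := hne (a * b) ht0
  have ht3 : t ≠ 0 := by
    intro h0
    rw [h0, subst_zero_of_constantCoeff_zero (constantCoeff_momentSeries ψ _)] at hmt
    exact X_ne_zero hmt.symm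
  generalize (PowerSeries.subst x (momentSeries φ a) : ℂ⟦X⟧) = mx at *
  generalize (PowerSeries.subst y (momentSeries φ b) : ℂ⟦X⟧) = my at *
  generalize (PowerSeries.subst t (momentSeries φ (a * b)) : ℂ⟦X⟧) = mt at *
  generalize mapLin φ p = P at *
  generalize mapLin φ q = Q at *
  generalize ctTransform φ ψ a ha = Ta at *
  generalize ctTransform φ ψ b hb = Tb at *
  generalize ctTransform φ ψ (a * b) hab = Tab at *
  obtain rfl : mx = X + X * P := by linear_combination -hα
  obtain rfl : my = X + X * Q := by linear_combination -hβ
  -- With denominators cleared, the claim follows from `z M_ab(t)/(1 + M_ab(t)) = (1 + z) ·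
  -- M_a(x)/(1 + M_a(x)) · M_b(y)/(1 + M_b(y))`, a consequence of `hγ`, on dividing by `z t = (1 +
  -- z) x y`.
  refine mul_left_cancel₀ (mul_ne_zero (mul_ne_zero (X_ne_zero (R := ℂ)) (mul_ne_zero ht3 ht2))
    (mul_ne_zero hx2 hy2)) ?_
  linear_combination X * (1 + X + X * P) * (1 + X + X * Q) * ht1 + X * hγ -
    (1 + mt) * (1 + X + X * P) * (1 + X + X * Q) * Ta * Tb * hxyt -
    (1 + mt) * (1 + X) * (Tb * (y * (1 + X + X * Q)) * hx1 + (X + X * P) * hy1)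

end Multiplicative

/-- For `φ = ψ` the last gap is weighted like the others, so the two cumulant recursions coincide.
-/
theorem ctTransform_self {A : Type u} [Ring A] [Algebra ℂ A] (ψ : A →ₗ[ℂ] ℂ) {a : A}
    (ha : ψ a ≠ 0) : ctTransform ψ ψ a ha = tTransform ψ a ha := by
  have h : ∀ (n : ℕ) (b : Fin n → A), cfreeCumulant ψ ψ n b = freeCumulant ψ n b := by
    intro n
    induction n using Nat.strong_induction_on with
    | _ n ih =>
      intro b
      rw [cfreeCumulant, freeCumulant]
      congr 1
      refine sum_congr rfl fun c _ => ?_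
      rw [ih _ c.2]
      simp only [ite_self]
  simp only [ctTransform, tTransform, crTransform, rTransform, h]

end CFree

theorem mainTheorem3 :
    -- (i) `ᶜT_X` coincides with `T_X` when `φ = ψ`
    (∀ (A : Type u) [Ring A] [Algebra ℂ A] (φ ψ : A →ₗ[ℂ] ℂ) (X : A) (hX : ψ X ≠ 0),
      φ 1 = 1 → ψ 1 = 1 → φ = ψ →
        CFree.ctTransform φ ψ X hX = CFree.tTransform ψ X hX) ∧
    -- (ii) one expression recovers `M_X` from `T_X` and `ᶜT_X`, for all algebras and all `X`
    (∃ e : CFree.SeriesExpr,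
      ∀ (A : Type u) [Ring A] [Algebra ℂ A] (φ ψ : A →ₗ[ℂ] ℂ) (X : A) (hX : ψ X ≠ 0),
        φ 1 = 1 → ψ 1 = 1 →
          CFree.Evaluates (CFree.tTransform ψ X hX) (CFree.ctTransform φ ψ X hX) e
            (CFree.momentSeries φ X)) ∧
    -- (iii) `ᶜT` is multiplicative on c-free elements (and `ᶜT_{XY}` is defined)
    (∀ (A : Type u) [Ring A] [Algebra ℂ A] (φ ψ : A →ₗ[ℂ] ℂ) (X Y : A)
      (hX : ψ X ≠ 0) (hY : ψ Y ≠ 0),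
      φ 1 = 1 → ψ 1 = 1 → CFree.AreCFree φ ψ X Y →
        ∃ hXY : ψ (X * Y) ≠ 0,
          CFree.ctTransform φ ψ (X * Y) hXY =
            CFree.ctTransform φ ψ X hX * CFree.ctTransform φ ψ Y hY) := by
  exact ⟨fun A _ _ φ ψ X hX _ _ h => by subst h; exact CFree.ctTransform_self φ hX,
    ⟨CFree.momentExpr, fun A _ _ φ ψ X hX hφ hψ => CFree.evaluates_momentExpr hφ hψ hX⟩,
    fun A _ _ φ ψ X Y hX hY hφ hψ h => h.ctTransform_mul hφ hψ hX hY⟩
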